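/- Let $F$ be a finite field, $G$ a profinite group, $K \unlhd G$ a closed normal subgroup, and $W$ an irreducible (profinite) $F[[G]]$-module. Let $V$ be an irreducible summand of $\operatorname{Res}^G_K W$, let $E = \operatorname{End}_{F[[K]]}(V)$ (a finite field, over which $V$ is a vector space), and let $H = \{g \in G : {}^gV \cong V \text{ as } F[[K]]\text{-modules}\}$ be the inertia group of $V$, where ${}^gV$ is $V$ with $k \in K$ acting as $g^{-1}kg$; then $K \le H$. Terminology: let $Q$ be a profinite group acting continuously on $E$ by a homomorphism $\gamma : Q \to \operatorname{Aut}_F(E)$. A $2$-cocycle $\alpha \in Z^2(Q,E^\times)$ with respect to $\gamma$ is a continuous map $\alpha : Q \times Q \to E^\times$ with $\gamma_g(\alpha(h,j))\,\alpha(g,hj) = \alpha(g,h)\,\alpha(gh,j)$ for all $g,h,j\in Q$. A finite $E^\alpha[[Q]]$-module is a finite-dimensional $E$-vector space $M$ on which each $g \in Q$ acts by a $\gamma_g$-semilinear map, such that $1$ acts as the identity, $g(hm) = \alpha(g,h)\,(gh)m$ for all $g,h \in Q$ and $m\in M$, and $g \mapsto gm$ is locally constant for every $m$. It is irreducible if it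 is nonzero and has no $Q$-stable $E$-subspaces other than $0$ and $M$. An action or cocycle of $H/K$ is also viewed as one of $H$ via $H \to H/K$. Then $H$ is open in $G$, and there exist a continuous action $\gamma : H/K \to \operatorname{Aut}_F(E)$, a $2$-cocycle $\alpha \in Z^2(H/K, E^\times)$ with respect to $\gamma$, an extension $\operatorname{ext}(V)$ of $V$ to an $E^{\alpha}[[H]]$-module (that is, an $E^{\alpha}[[H]]$-module structure on the $E$-vector space $V$ in which the elements of $K$ act as they do on $V$), and an irreducible finite $E^{\alpha^{-1}}[[H/K]]$-module $U'$ such that $$W \cong \operatorname{Ind}_H^G\bigl(U' \otimes_E \operatorname{ext}(V)\bigr)$$ as $F[[G]]$-modules, where $h \in H$ acts on $U' \otimes_E \operatorname{ext}(V)$ by $h(u \otimes v) = (hK)u \otimes hv$, and $\operatorname{Ind}_H^G(M) = F[G] \otimes_{F[H]} M = F[[G]] \otimes_{F[[H]]} M$. -/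

import Mathlib

open scoped TensorProduct

universe w

noncomputable section

namespace TwistedClifford

/-! ### Profinite modules over completed group algebras

A profinite `F⟦G⟧`-module (`F` a finite field with the discrete topology, `G` a profinite group)
is a profinite `F`-vector space with a continuous `F`-linear action of `G`. -/

section Modules

variable {F G W : Type*} [Field F] [Group G] [TopologicalSpace G]
  [AddCommGroup W] [Module F W] [TopologicalSpace W]

/-- The representation `ρ` makes the topological space `W` into a profinite `F⟦G⟧`-module. -/
structure IsProfiniteModule (ρ : Representation F G W) : Prop where
  isTopologicalAddGroup : IsTopologicalAddGroup W
  compactSpace : CompactSpace W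
  t2Space : T2Space W
  totallyDisconnectedSpace : TotallyDisconnectedSpace W
  continuous_const_smul : ∀ c : F, Continuous fun w : W => c • w
  continuous_action : Continuous fun p : G × W => ρ p.1 p.2

/-- The profinite module `ρ` is irreducible: it is nonzero, and `0` and the whole module are its
only (closed) submodules. -/
structure IsIrreducibleModule (ρ : Representation F G W) : Prop extends IsProfiniteModule ρ where
  nontrivial : Nontrivial W
  eq_bot_or_eq_top : ∀ S : Subrepresentation ρ, IsClosed (S : Set W) → S = ⊥ ∨ S = ⊤

/-- The restriction of a representation of `G` to a subgroup. -/
def res (K : Subgroup G) (ρ : Representation F G W) : Representation F K W :=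
  ρ.comp K.subtype

/-- `V` is a direct summand of the profinite module `ρ`: it is closed and has a closed complement
that is stable under the group. -/
def IsSummand {ρ : Representation F G W} (V : Subrepresentation ρ) : Prop :=
  IsClosed (V : Set W) ∧ ∃ V' : Subrepresentation ρ, IsClosed (V' : Set W) ∧ IsCompl V V'

/-- An irreducible profinite module is finite. -/
theorem IsIrreducibleModule.finite [Finite F] [CompactSpace G] {ρ : Representation F G W}
    (h : IsIrreducibleModule ρ) : Finite W := by
  have := h.isTopologicalAddGroup
  have := h.compactSpace
  have := h.t2Space
  have := h.totallyDisconnectedSpace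
  have := h.nontrivial
  obtain ⟨w, hw⟩ := exists_ne (0 : W)
  obtain ⟨C, hC, h0C, hCw⟩ := compact_exists_isClopen_in_isOpen
    (isOpen_compl_singleton (x := w)) (x := (0 : W)) (by simpa using hw.symm)
  obtain ⟨U, hU⟩ := IsTopologicalAddGroup.exist_openAddSubgroup_sub_clopen_nhds_of_zero hC h0C
  have hopen : ∀ c : F, IsOpen {v : W | ∀ g : G, ρ g (c • v) ∈ U} := by
    intro c
    have hcont : Continuous fun p : G × W => ρ p.1 (c • p.2) :=
      h.continuous_action.comp
        (continuous_fst.prodMk ((h.continuous_const_smul c).comp continuous_snd))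
    have hcl : IsClosed {p : G × W | ρ p.1 (c • p.2) ∉ U} :=
      (U.isOpen.preimage hcont).isClosed_compl
    have := (isClosedMap_snd_of_compactSpace (X := G) (Y := W) _ hcl).isOpen_compl
    convert this using 1
    ext v
    simp
  let S : Subrepresentation ρ :=
    { toSubmodule :=
        { carrier := {v | ∀ (c : F) (g : G), ρ g (c • v) ∈ U}
          add_mem' := by
            intro a b ha hb c g
            rw [smul_add, map_add]
            exact U.toAddSubgroup.add_mem (ha c g) (hb c g)
          zero_mem' := by
            intro c g
            rw [smul_zero, map_zero]
            exact U.toAddSubgroup.zero_mem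
          smul_mem' := by
            intro d v hv c g
            rw [smul_smul]
            exact hv _ g }
      apply_mem_toSubmodule := by
        intro g v hv c g'
        rw [← map_smul, ← Module.End.mul_apply, ← map_mul]
        exact hv c _ }
  have hSopen : IsOpen (S : Set W) := by
    have : (S : Set W) = ⋂ c : F, {v : W | ∀ g : G, ρ g (c • v) ∈ U} := by
      ext v
      simp only [Set.mem_iInter, Set.mem_ofPred_eq]
      rfl
    rw [this]
    exact isOpen_iInter_of_finite hopen
  have hSclosed : IsClosed (S : Set W) :=
    AddSubgroup.isClosed_of_isOpen S.toSubmodule.toAddSubgroup hSopen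
  rcases h.eq_bot_or_eq_top S hSclosed with hS | hS
  · have h0 : IsOpen ({0} : Set W) := by
      have : (S : Set W) = {0} := by
        rw [hS]
        rfl
      rwa [this] at hSopen
    have : DiscreteTopology W := discreteTopology_of_isOpen_singleton_zero h0
    exact finite_of_compact_of_discrete
  · exfalso
    have hwS : w ∈ S := by
      rw [hS]
      exact Submodule.mem_top (R := F)
    have := hwS 1 1
    rw [map_one, one_smul] at this
    exact hCw (hU this) rfl

end Modules

instance compactSpace_of_isClosed {G : Type*} [Group G] [TopologicalSpace G] [CompactSpace G]
    (K : Subgroup G) [hK : IsClosed (K : Set G)] : CompactSpace K :=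
  isCompact_iff_compactSpace.mp hK.isCompact

/-! ### The endomorphism field of an irreducible module -/

section EndField

variable {F K V : Type*} [Field F] [Group K] [TopologicalSpace K]
  [AddCommGroup V] [Module F V] [TopologicalSpace V]

/-- The algebra `End_{F⟦K⟧}(V)` of continuous `F`-linear endomorphisms of a profinite module `V`
that commute with the action of `K`. -/
def endAlgebra {σ : Representation F K V} (hσ : IsProfiniteModule σ) :
    Subalgebra F (Module.End F V) where
  carrier := {f | Continuous f ∧ ∀ k v, f (σ k v) = σ k (f v)}
  mul_mem' := by
    rintro f g ⟨hf, hf'⟩ ⟨hg, hg'⟩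
    refine ⟨hf.comp hg, fun k v => ?_⟩
    rw [Module.End.mul_apply, Module.End.mul_apply, hg', hf']
  add_mem' := by
    rintro f g ⟨hf, hf'⟩ ⟨hg, hg'⟩
    have := hσ.isTopologicalAddGroup
    refine ⟨hf.add hg, fun k v => ?_⟩
    rw [LinearMap.add_apply, LinearMap.add_apply, map_add, hf', hg']
  algebraMap_mem' := by
    intro c
    refine ⟨hσ.continuous_const_smul c, fun k v => ?_⟩
    rw [Module.algebraMap_end_apply, Module.algebraMap_end_apply, map_smul]

/-- The endomorphism ring `E = End_{F⟦K⟧}(V)` of an irreducible module `V`; it is a finite field,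
and `V` is an `E`-vector space by evaluation of endomorphisms. -/
def EndField {σ : Representation F K V} (hσ : IsIrreducibleModule σ) : Type _ :=
  endAlgebra hσ.toIsProfiniteModule

namespace EndField

variable {σ : Representation F K V} (hσ : IsIrreducibleModule σ)

theorem eq_zero_or_injective (f : endAlgebra hσ.toIsProfiniteModule) :
    f = 0 ∨ Function.Injective f.1 := by
  have := hσ.t2Space
  let S : Subrepresentation σ :=
    { toSubmodule := LinearMap.ker f.1
      apply_mem_toSubmodule := by
        intro k v hv
        rw [LinearMap.mem_ker] at hv ⊢
        rw [f.2.2, hv, map_zero] }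
  have hS : IsClosed (S : Set V) := isClosed_singleton.preimage f.2.1
  rcases hσ.eq_bot_or_eq_top S hS with h | h
  · right
    exact LinearMap.ker_eq_bot.mp (congrArg Subrepresentation.toSubmodule h)
  · left
    exact Subtype.ext (LinearMap.ker_eq_top.mp (congrArg Subrepresentation.toSubmodule h))

variable [Finite F] [CompactSpace K]

theorem isField : IsField (endAlgebra hσ.toIsProfiniteModule) := by
  have := hσ.finite
  have := hσ.nontrivial
  have : Finite (Module.End F V) := DFunLike.finite _
  have : NoZeroDivisors (endAlgebra hσ.toIsProfiniteModule) := by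
    refine ⟨fun {f g} hfg => ?_⟩
    rcases eq_zero_or_injective hσ f with hf | hf
    · exact Or.inl hf
    · right
      ext v
      apply hf
      have := LinearMap.congr_fun (congrArg Subtype.val hfg) v
      simpa using this
  have : IsDomain (endAlgebra hσ.toIsProfiniteModule) := NoZeroDivisors.to_isDomain _
  exact Finite.isDomain_to_isField _

instance : Field (EndField hσ) := (isField hσ).toField

instance : Algebra F (EndField hσ) :=
  inferInstanceAs (Algebra F (endAlgebra hσ.toIsProfiniteModule))

instance : Module (EndField hσ) V :=
  inferInstanceAs (Module (endAlgebra hσ.toIsProfiniteModule) V)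

instance : IsScalarTower F (EndField hσ) V :=
  inferInstanceAs (IsScalarTower F (endAlgebra hσ.toIsProfiniteModule) V)

instance : Finite (EndField hσ) := by
  have := hσ.finite
  have : Finite (Module.End F V) := DFunLike.finite _
  exact inferInstanceAs (Finite (endAlgebra hσ.toIsProfiniteModule))

theorem smul_def (e : EndField hσ) (v : V) : e • v = e.1 v := rfl

theorem mul_def (e e' : EndField hσ) : (e * e').1 = e.1 * e'.1 := rfl

theorem add_def (e e' : EndField hσ) : (e + e').1 = e.1 + e'.1 := rfl

theorem one_def : (1 : EndField hσ).1 = 1 := rfl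

theorem zero_def : (0 : EndField hσ).1 = 0 := rfl

end EndField

end EndField

/-! ### The inertia group -/

section Inertia

variable {F G V : Type*} [Field F] [Group G] {K : Subgroup G} [K.Normal]
  [AddCommGroup V] [Module F V]

/-- The conjugate `ᵍV` of a representation `V` of a normal subgroup `K` by `g`: the element `k`
acts on `ᵍV` as `g⁻¹kg` acts on `V`. -/
def conjRep (σ : Representation F K V) (g : G) : Representation F K V :=
  σ.comp (MulAut.conjNormal g⁻¹).toMonoidHom

theorem conjRep_mul (σ : Representation F K V) (g h : G) :
    conjRep σ (g * h) = conjRep (conjRep σ h) g := by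
  ext k v
  simp [conjRep, mul_inv_rev]

theorem conjRep_one (σ : Representation F K V) : conjRep σ (1 : G) = σ := by
  ext k v
  simp [conjRep]

variable [TopologicalSpace V]

/-- The inertia group of `V`: the group of all `g` such that `ᵍV` and `V` are isomorphic as
topological `K`-modules. -/
def inertia (σ : Representation F K V) : Subgroup G where
  carrier := {g | ∃ f : V ≃L[F] V, ∀ k v, f (conjRep σ g k v) = σ k (f v)}
  mul_mem' := by
    rintro g h ⟨f, hf⟩ ⟨f', hf'⟩
    refine ⟨f'.trans f, fun k v => ?_⟩
    have e : conjRep σ (g * h) k v = conjRep σ h (MulAut.conjNormal g⁻¹ k) v := by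
      rw [conjRep_mul]
      rfl
    rw [e, ContinuousLinearEquiv.trans_apply, ContinuousLinearEquiv.trans_apply, hf']
    exact hf k (f' v)
  one_mem' := by
    refine ⟨ContinuousLinearEquiv.refl F V, fun k v => ?_⟩
    rw [conjRep_one]
    rfl
  inv_mem' := by
    rintro g ⟨f, hf⟩
    refine ⟨f.symm, fun k v => ?_⟩
    apply f.injective
    rw [f.apply_symm_apply]
    have := hf (MulAut.conjNormal g k) (f.symm v)
    rw [f.apply_symm_apply] at this
    have e1 : conjRep σ g⁻¹ k v = σ (MulAut.conjNormal g k) v := by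
      simp [conjRep]
    have e2 : conjRep σ g (MulAut.conjNormal g k) (f.symm v) = σ k (f.symm v) := by
      simp [conjRep]
    rw [e1, ← this, e2]

theorem le_inertia (σ : Representation F K V) (hσ : ∀ k, Continuous (σ k)) :
    K ≤ inertia σ := by
  intro g hg
  have inv1 : ∀ (k : K) v, σ k (σ k⁻¹ v) = v := fun k v => by
    rw [← Module.End.mul_apply, ← map_mul]
    simp
  have inv2 : ∀ (k : K) v, σ k⁻¹ (σ k v) = v := fun k v => by
    rw [← Module.End.mul_apply, ← map_mul]
    simp
  refine ⟨{ toFun := σ ⟨g, hg⟩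
            invFun := σ ⟨g, hg⟩⁻¹
            map_add' := map_add _
            map_smul' := map_smul _
            left_inv := inv2 _
            right_inv := inv1 _
            continuous_toFun := hσ _
            continuous_invFun := hσ _ }, fun k v => ?_⟩
  change σ ⟨g, hg⟩ (σ (MulAut.conjNormal g⁻¹ k) v) = σ k (σ ⟨g, hg⟩ v)
  rw [← Module.End.mul_apply, ← map_mul, ← Module.End.mul_apply, ← map_mul]
  congr 2
  ext
  simp [mul_assoc]

/-- An irreducible `K`-module has inertia group containing `K`. -/
theorem IsIrreducibleModule.le_inertia [TopologicalSpace G] {σ : Representation F K V}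
    (hσ : IsIrreducibleModule σ) : K ≤ inertia σ :=
  TwistedClifford.le_inertia σ fun _ =>
    hσ.continuous_action.comp (continuous_const.prodMk continuous_id)

/-- The quotient `H/K` of the inertia group `H` of `V` by `K` (more precisely by `H ∩ K`; note that
`K ≤ H` if `V` is irreducible), with the quotient topology. -/
abbrev InertiaQuotient (σ : Representation F K V) : Type _ :=
  inertia σ ⧸ K.subgroupOf (inertia σ)

/-- The quotient homomorphism `H → H/K`. -/
def toQuotient (σ : Representation F K V) : inertia σ →* InertiaQuotient σ :=
  QuotientGroup.mk' (K.subgroupOf (inertia σ))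

theorem continuous_toQuotient [TopologicalSpace G] (σ : Representation F K V) :
    Continuous (toQuotient σ) :=
  continuous_quotient_mk'

end Inertia

/-! ### Crossed projective representations -/

section Crossed

variable {F E G Q M N : Type*} [Field F] [Field E] [Algebra F E]
  [Group G] [TopologicalSpace G] [Group Q] [TopologicalSpace Q]
  [AddCommGroup M] [Module E M] [AddCommGroup N] [Module E N]

/-- `α` is a continuous `2`-cocycle of `G` in `Eˣ` (discrete), with respect to the action `γ`. -/
structure IsTwoCocycle (γ : G →* (E ≃ₐ[F] E)) (α : G × G → Eˣ) : Prop where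
  isLocallyConstant : IsLocallyConstant α
  cocycle : ∀ g h j : G,
    γ g (α (h, j)) * (α (g, h * j) : E) = (α (g, h) : E) * (α (g * h, j) : E)

/-- An `α`-representation of `G` on the discrete `E`-vector space `M` with respect to an action `γ`
of `G` on `E` (that is, a discrete `E^α⟦G⟧`-module structure on `M`): every `g` acts on `M` by a
`γ g`-semilinear map `ρ g`, with `ρ 1 = 1` and `ρ g ∘ ρ h = α(g,h) ρ (gh)`, continuously. -/
structure CrossedRep (γ : G →* (E ≃ₐ[F] E)) (α : G × G → Eˣ) (M : Type*)
    [AddCommGroup M] [Module E M] where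
  act : ∀ g : G, M →ₛₗ[(RingHomClass.toRingHom (γ g) : E →+* E)] M
  act_one : ∀ m, act 1 m = m
  act_act : ∀ g h m, act g (act h m) = (α (g, h) : E) • act (g * h) m
  isLocallyConstant_act : ∀ m, IsLocallyConstant fun g => act g m

namespace CrossedRep

variable {γ : G →* (E ≃ₐ[F] E)} {α β : G × G → Eˣ}

/-- The `α`-representation is irreducible: it is nonzero and has no proper nonzero `E`-subspace
that is stable under the group. -/
def IsIrreducible (ρ : CrossedRep γ α M) : Prop :=
  Nontrivial M ∧
    ∀ S : Submodule E M, (∀ g, ∀ m ∈ S, ρ.act g m ∈ S) → S = ⊥ ∨ S = ⊤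

/-- Inflation of an `α`-representation along a continuous homomorphism `f`. -/
def inflate {γ : Q →* (E ≃ₐ[F] E)} {α : Q × Q → Eˣ} (ρ : CrossedRep γ α M)
    (f : G →* Q) (hf : Continuous f) :
    CrossedRep (γ.comp f) (α ∘ Prod.map f f) M where
  act g := ρ.act (f g)
  act_one m := by
    have : ρ.act (f 1) m = ρ.act 1 m := by
      rw [← map_one f]
    rw [this, ρ.act_one]
  act_act g h m := by
    have : ρ.act (f (g * h)) m = ρ.act (f g * f h) m := by
      rw [← map_mul f]
    rw [this, ρ.act_act]
    rfl
  isLocallyConstant_act m := (ρ.isLocallyConstant_act m).comp_continuous hf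

/-- The tensor product over `E` of an `α`-representation and a `β`-representation, as an
`αβ`-representation. -/
def tensor (ρ : CrossedRep γ α M) (τ : CrossedRep γ β N) :
    CrossedRep γ (α * β) (M ⊗[E] N) where
  act g := TensorProduct.map (ρ.act g) (τ.act g)
  act_one x := by
    induction x using TensorProduct.induction_on with
    | zero => rw [map_zero]
    | tmul m n => rw [TensorProduct.map_tmul, ρ.act_one, τ.act_one]
    | add x y hx hy => rw [map_add, hx, hy]
  act_act g h x := by
    induction x using TensorProduct.induction_on with
    | zero => simp only [map_zero, smul_zero]
    | tmul m n =>
      rw [TensorProduct.map_tmul, TensorProduct.map_tmul, TensorProduct.map_tmul, ρ.act_act,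
        τ.act_act, TensorProduct.smul_tmul_smul]
      rfl
    | add x y hx hy => simp only [map_add, smul_add, hx, hy]
  isLocallyConstant_act x := by
    induction x using TensorProduct.induction_on with
    | zero =>
      simp only [map_zero]
      exact IsLocallyConstant.const 0
    | tmul m n =>
      simp only [TensorProduct.map_tmul]
      exact (ρ.isLocallyConstant_act m).comp₂ (τ.isLocallyConstant_act n) (· ⊗ₜ[E] ·)
    | add x y hx hy =>
      simp only [map_add]
      exact hx.add hy

/-- If the cocycle `α` is trivial, then an `α`-representation is an `F`-linear representation. -/
def toRepresentation [Module F M] [IsScalarTower F E M] (ρ : CrossedRep γ α M)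
    (hα : α = 1) : Representation F G M where
  toFun g :=
    { toFun := ρ.act g
      map_add' := map_add _
      map_smul' := fun c m => by
        rw [← algebraMap_smul E c m, map_smulₛₗ, RingHom.id_apply,
          ← algebraMap_smul E c (ρ.act g m)]
        congr 1
        exact (γ g).commutes c }
  map_one' := LinearMap.ext ρ.act_one
  map_mul' g h := LinearMap.ext fun m => by
    have h1 := ρ.act_act g h m
    have h2 : (α (g, h) : E) = 1 := by
      rw [hα]
      rfl
    rw [h2, one_smul] at h1
    exact h1.symm

end CrossedRep

theorem comp_inv_mul_comp {E X Y : Type*} [Field E] (f : X → Y) (α : Y × Y → Eˣ) :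
    (α⁻¹ ∘ Prod.map f f) * (α ∘ Prod.map f f) = 1 := by
  ext p
  simp

/-- The representation `U ⊗_E M` of `G` over `F`, for an `α⁻¹`-representation `U` of `Q` and an
`α`-representation `M` of `G`, where `γ` and `α` are lifted from `Q` to `G` along a continuous
homomorphism `f : G → Q`: the element `g` sends `u ⊗ m` to `gu ⊗ gm`. -/
def tensorInflate {U : Type*} [AddCommGroup U] [Module E U] [Module F U] [IsScalarTower F E U]
    {γ : Q →* (E ≃ₐ[F] E)} {α : Q × Q → Eˣ} (ρ : CrossedRep γ α⁻¹ U)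
    (f : G →* Q) (hf : Continuous f) (τ : CrossedRep (γ.comp f) (α ∘ Prod.map f f) M) :
    Representation F G (U ⊗[E] M) :=
  ((ρ.inflate f hf).tensor τ).toRepresentation (comp_inv_mul_comp f α)

theorem tensorInflate_tmul {U : Type*} [AddCommGroup U] [Module E U] [Module F U]
    [IsScalarTower F E U] {γ : Q →* (E ≃ₐ[F] E)} {α : Q × Q → Eˣ} (ρ : CrossedRep γ α⁻¹ U)
    (f : G →* Q) (hf : Continuous f) (τ : CrossedRep (γ.comp f) (α ∘ Prod.map f f) M)
    (g : G) (u : U) (m : M) :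
    tensorInflate ρ f hf τ g (u ⊗ₜ[E] m) = ρ.act (f g) u ⊗ₜ[E] τ.act g m := rfl

end Crossed

end TwistedClifford

end

open TwistedClifford

/-! Write σ for the action of `K` on `V` and H for its inertia group. An irreducible `W` is finite,
hence discrete, so `ρ` is locally constant with open kernel. Elements with the same image under `ρ`
have the same conjugates of `V`, so H contains this kernel and is open.

For each h in H choose an isomorphism T_h from ʰV to V. By Schur's lemma two choices for the same h
differ by a scalar of E = `EndField`. Hence T_g T_h = α(g,h) T_{gh} with α(g,h) in Eˣ, and
conjugation by T_h is an automorphism γ_h of E. Associativity is the cocycle identity. If T_{hk} =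
T_h σ(k) for k in `K`, then α and γ descend to H/K and T extends σ; `exists_twistSystem` arranges
this together with local constancy.

Take U' = Hom_K(V, W), with h acting by u ↦ ρ(h) u T_h⁻¹. The inverse of T_h makes this an
α⁻¹-representation, and `K` acts trivially. Evaluation u ⊗ v ↦ u(v) is H-equivariant because the
twists cancel, so it induces a G-map from Ind(U' ⊗ V) to W. It is surjective because its image is a
nonzero submodule (`exists_sum_translates_eq`). It is injective by
`eq_zero_of_sum_translates_eq_zero`: a nontrivial relation among translates of an E-basis of U',
taken with minimal support, yields intertwiners between conjugates of V, which vanish between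
distinct cosets of H and are scalars of E within one coset. The same two lemmas show that U' is
irreducible: a nonzero stable proper subspace would already generate W, contradicting independence
of one further homomorphism. -/

open TwistedClifford

noncomputable section

namespace TwistedClifford

/-! ### Isomorphisms between V and its conjugates -/

section Twists

variable {F G V : Type*} [Field F] [Group G] {K : Subgroup G} [K.Normal]
  [AddCommGroup V] [Module F V]

/-- The action of a group on a representation, by linear automorphisms. -/
def actEquiv (σ : Representation F K V) : K →* (V ≃ₗ[F] V) :=
  (LinearMap.GeneralLinearGroup.generalLinearEquiv F V).toMonoidHom.comp σ.toHomUnits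

omit [K.Normal] in
theorem actEquiv_apply (σ : Representation F K V) (k : K) (v : V) :
    actEquiv σ k v = σ k v := rfl

/-- The linear automorphism `T` is an isomorphism from the conjugate `ᵍV` to `V`. -/
def IsTwist (σ : Representation F K V) (g : G) (T : V ≃ₗ[F] V) : Prop :=
  ∀ k v, T (conjRep σ g k v) = σ k (T v)

theorem conjRep_apply (σ : Representation F K V) (g : G) (k : K) (v : V) :
    conjRep σ g k v = σ (MulAut.conjNormal g⁻¹ k) v := rfl

theorem conjRep_conjNormal (σ : Representation F K V) (g : G) (k : K) :
    conjRep σ g (MulAut.conjNormal g k) = σ k := by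
  ext v
  simp [conjRep_apply]

namespace IsTwist

variable {σ : Representation F K V} {g h : G} {S T : V ≃ₗ[F] V}

theorem symm_apply (hT : IsTwist σ g T) (k : K) (v : V) :
    T.symm (σ k v) = conjRep σ g k (T.symm v) := by
  apply T.injective
  rw [hT, T.apply_symm_apply, T.apply_symm_apply]

theorem mul (hT : IsTwist σ g T) (hS : IsTwist σ h S) : IsTwist σ (g * h) (T * S) := by
  intro k v
  rw [conjRep_mul]
  exact (congrArg T (hS _ v)).trans (hT k (S v))

theorem inv (hT : IsTwist σ g T) : IsTwist σ g⁻¹ T⁻¹ := by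
  intro k v
  have := hT.symm_apply (MulAut.conjNormal g k) v
  rw [conjRep_conjNormal] at this
  rw [conjRep_apply, inv_inv]
  exact this

theorem one (σ : Representation F K V) : IsTwist σ (1 : G) 1 := by
  intro k v
  rw [conjRep_one]
  rfl

theorem actEquiv (σ : Representation F K V) (k : K) : IsTwist σ (k : G) (actEquiv σ k) := by
  intro k' v
  rw [actEquiv_apply, actEquiv_apply, conjRep_apply, ← Module.End.mul_apply, ← map_mul,
    ← Module.End.mul_apply, ← map_mul]
  congr 2
  ext
  simp [mul_assoc]

end IsTwist

theorem mem_inertia_iff [TopologicalSpace V] [DiscreteTopology V] {σ : Representation F K V}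
    {g : G} : g ∈ inertia σ ↔ ∃ T, IsTwist σ g T := by
  constructor
  · rintro ⟨f, hf⟩
    exact ⟨f.toLinearEquiv, hf⟩
  · rintro ⟨T, hT⟩
    exact ⟨{ T with
      continuous_toFun := continuous_of_discreteTopology
      continuous_invFun := continuous_of_discreteTopology }, hT⟩

end Twists

/-! ### Schur's lemma: twists and the endomorphism field -/

section Scalars

namespace EndField

variable {F K V : Type*} [Field F] [Finite F] [Group K] [TopologicalSpace K] [CompactSpace K]
  [AddCommGroup V] [Module F V] [TopologicalSpace V]
  {σ : Representation F K V} {hσ : IsIrreducibleModule σ}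

theorem ext_smul {e e' : EndField hσ} (h : ∀ v : V, e • v = e' • v) : e = e' :=
  Subtype.ext (LinearMap.ext h)

theorem smul_comm_act (e : EndField hσ) (k : K) (v : V) : e • σ k v = σ k (e • v) :=
  e.2.2 k v

theorem mul_smul (e e' : EndField hσ) (v : V) : (e * e') • v = e • e' • v := rfl

variable [DiscreteTopology V]

/-- A linear endomorphism commuting with the action, as an element of the endomorphism field. -/
def ofEnd (hσ : IsIrreducibleModule σ) (f : Module.End F V) (hf : ∀ k v, f (σ k v) = σ k (f v)) :
    EndField hσ :=
  ⟨f, continuous_of_discreteTopology, hf⟩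

theorem ofEnd_smul (f : Module.End F V) (hf : ∀ k v, f (σ k v) = σ k (f v)) (v : V) :
    ofEnd hσ f hf • v = f v := rfl

end EndField

variable {F G V : Type*} [Field F] [Finite F] [Group G] [TopologicalSpace G]
  {K : Subgroup G} [K.Normal] [CompactSpace K]
  [AddCommGroup V] [Module F V] [TopologicalSpace V] [DiscreteTopology V]
  {σ : Representation F K V} (hσ : IsIrreducibleModule σ)

namespace IsTwist

variable {g : G} {S T : V ≃ₗ[F] V}

omit [DiscreteTopology V] in
theorem conj_comm (hT : IsTwist σ g T) (e : EndField hσ) (k : K) (v : V) :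
    T (e • T.symm (σ k v)) = σ k (T (e • T.symm v)) := by
  rw [hT.symm_apply, conjRep_apply, EndField.smul_comm_act, ← conjRep_apply, hT]

/-- Conjugation of endomorphisms by a twist. -/
def conjEnd (hT : IsTwist σ g T) (e : EndField hσ) : EndField hσ :=
  EndField.ofEnd hσ (T.toLinearMap ∘ₗ e.1 ∘ₗ T.symm.toLinearMap) (hT.conj_comm hσ e)

theorem conjEnd_smul (hT : IsTwist σ g T) (e : EndField hσ) (v : V) :
    hT.conjEnd hσ e • v = T (e • T.symm v) := rfl

/-- Conjugation by a twist, as an automorphism of the endomorphism field. -/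
def conjEndEquiv (hT : IsTwist σ g T) : EndField hσ ≃ₐ[F] EndField hσ where
  toFun := hT.conjEnd hσ
  invFun := hT.inv.conjEnd hσ
  left_inv e := EndField.ext_smul fun v => by
    rw [conjEnd_smul, conjEnd_smul]
    exact (T.symm_apply_apply _).trans (congrArg (e • ·) (T.symm_apply_apply v))
  right_inv e := EndField.ext_smul fun v => by
    rw [conjEnd_smul, conjEnd_smul]
    exact (T.apply_symm_apply _).trans (congrArg (e • ·) (T.apply_symm_apply v))
  map_mul' e e' := EndField.ext_smul fun v => by
    simp only [conjEnd_smul, EndField.mul_smul, T.symm_apply_apply]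
  map_add' e e' := EndField.ext_smul fun v => by
    simp only [conjEnd_smul, add_smul, map_add]
  commutes' c := EndField.ext_smul fun v => by
    simp only [conjEnd_smul, algebraMap_smul, map_smul, T.apply_symm_apply]

theorem apply_smul (hT : IsTwist σ g T) (e : EndField hσ) (v : V) :
    T (e • v) = hT.conjEndEquiv hσ e • T v := by
  change _ = hT.conjEnd hσ e • T v
  rw [conjEnd_smul, T.symm_apply_apply]

omit [Finite F] [TopologicalSpace G] [CompactSpace ↥K] [TopologicalSpace V] [DiscreteTopology V] in
theorem ratio_comm (hT : IsTwist σ g T) (hS : IsTwist σ g S) (k : K) (v : V) :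
    T (S.symm (σ k v)) = σ k (T (S.symm v)) := by
  rw [hS.symm_apply, hT]

/-- The scalar by which two twists for the same group element differ. -/
def ratio (hT : IsTwist σ g T) (hS : IsTwist σ g S) : (EndField hσ)ˣ where
  val := EndField.ofEnd hσ (T.toLinearMap ∘ₗ S.symm.toLinearMap) (hT.ratio_comm hS)
  inv := EndField.ofEnd hσ (S.toLinearMap ∘ₗ T.symm.toLinearMap) (hS.ratio_comm hT)
  val_inv := EndField.ext_smul fun v => by
    rw [EndField.mul_smul, one_smul, EndField.ofEnd_smul, EndField.ofEnd_smul]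
    simp
  inv_val := EndField.ext_smul fun v => by
    rw [EndField.mul_smul, one_smul, EndField.ofEnd_smul, EndField.ofEnd_smul]
    simp

theorem ratio_smul (hT : IsTwist σ g T) (hS : IsTwist σ g S) (v : V) :
    (hT.ratio hσ hS : EndField hσ) • S v = T v := by
  change T (S.symm (S v)) = T v
  rw [S.symm_apply_apply]

end IsTwist

end Scalars

/-! ### Openness of the inertia group and a coherent choice of twists -/

section TwistSystem

variable {F G V : Type*} [Field F] [Finite F] [Group G] [TopologicalSpace G]
  {K : Subgroup G} [K.Normal]
  [AddCommGroup V] [Module F V] [TopologicalSpace V]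

/-- A locally constant choice of isomorphisms from `ʰV` to `V`, compatible with the action of
`K`. -/
structure TwistSystem {σ : Representation F K V} (hσ : IsIrreducibleModule σ) where
  twist : inertia σ → V ≃ₗ[F] V
  isTwist : ∀ h : inertia σ, IsTwist σ (h : G) (twist h)
  twist_one : twist 1 = 1
  twist_mul : ∀ (h : inertia σ) (k : K) v, twist (h * ⟨k, hσ.le_inertia k.2⟩) v = twist h (σ k v)
  isLocallyConstant : IsLocallyConstant twist

omit [Finite F] [TopologicalSpace G] in
theorem conjRep_eq_of_eq {W : Type*} [AddCommGroup W] [Module F W] {ρ : Representation F G W}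
    (V : Subrepresentation (res K ρ)) {g h : G} (hgh : ρ g = ρ h) :
    conjRep V.toRepresentation g = conjRep V.toRepresentation h := by
  have inv : ρ g⁻¹ = ρ h⁻¹ := by
    calc ρ g⁻¹ = ρ g⁻¹ * (ρ h * ρ h⁻¹) := by rw [← map_mul, mul_inv_cancel, map_one, mul_one]
      _ = ρ h⁻¹ := by rw [← hgh, ← mul_assoc, ← map_mul, inv_mul_cancel, map_one, one_mul]
  ext k v
  change ρ (MulAut.conjNormal g⁻¹ k : K) v = ρ (MulAut.conjNormal h⁻¹ k : K) v
  rw [MulAut.conjNormal_apply, MulAut.conjNormal_apply, inv_inv, inv_inv]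
  simp only [map_mul, hgh, inv]

omit [Finite F] in
-- For finite discrete W the function space W → W is discrete, so pointwise continuity in g already
-- gives local constancy of the whole operator.
theorem isLocallyConstant_of_finite {W : Type*} [AddCommGroup W] [Module F W]
    [TopologicalSpace W] [DiscreteTopology W] [Finite W] {ρ : Representation F G W}
    (hρ : IsProfiniteModule ρ) : IsLocallyConstant fun g => ρ g := by
  apply IsLocallyConstant.desc _ (fun f : Module.End F W => (f : W → W)) _ DFunLike.coe_injective
  rw [IsLocallyConstant.iff_continuous]
  exact continuous_pi fun w => hρ.continuous_action.comp (continuous_id.prodMk continuous_const)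

omit [Finite F] in
theorem isOpen_inertia {W : Type*} [AddCommGroup W] [Module F W] [IsTopologicalGroup G]
    [TopologicalSpace W] [DiscreteTopology W] [Finite W] {ρ : Representation F G W}
    (hρ : IsProfiniteModule ρ) (V : Subrepresentation (res K ρ)) :
    IsOpen (inertia V.toRepresentation : Set G) := by
  refine Subgroup.isOpen_mono (H₁ := ρ.ker) (fun g hg => ?_)
    ((isLocallyConstant_of_finite hρ).isOpen_fiber 1)
  refine mem_inertia_iff.mpr ⟨1, ?_⟩
  have := IsTwist.one (G := G) V.toRepresentation
  intro k v
  rw [conjRep_eq_of_eq V (show ρ g = ρ 1 by rw [map_one]; exact hg)]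
  exact this k v

omit [Finite F] in
-- Twists are chosen freely only on representatives of the cosets of K · ker ρ in H. On the rest of
-- a coset they are forced by compatibility with `K`, and well defined because σ(k) depends only on
-- ρ(k).
theorem exists_twistSystem {W : Type*} [AddCommGroup W] [Module F W]
    [TopologicalSpace W] [DiscreteTopology W] [Finite W] {ρ : Representation F G W}
    (hρ : IsProfiniteModule ρ) (V : Subrepresentation (res K ρ))
    (hV : IsIrreducibleModule V.toRepresentation) : Nonempty (TwistSystem hV) := by
  set σ := V.toRepresentation with hσ
  let L : Subgroup (inertia σ) := (K ⊔ ρ.ker).subgroupOf (inertia σ)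
  let rep : inertia σ → inertia σ := fun h => (h : inertia σ ⧸ L).out
  -- Modulo ker ρ, each h differs from its representative by an element of `K`.
  have hrep : ∀ h, ∃ k : K, ρ ((rep h)⁻¹ * h : inertia σ) = ρ k := by
    intro h
    have : (rep h)⁻¹ * h ∈ L := QuotientGroup.eq.mp (QuotientGroup.out_eq' _)
    obtain ⟨k, hk, n, hn, hkn⟩ := Subgroup.mem_sup_of_normal_left.mp (Subgroup.mem_subgroupOf.mp this)
    refine ⟨⟨k, hk⟩, ?_⟩
    rw [← hkn, map_mul, show ρ n = 1 from hn, mul_one]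
  choose κ hκ using hrep
  have hκ' : ∀ h : inertia σ, ρ (rep h * κ h : G) = ρ h := by
    intro h
    rw [map_mul, ← hκ, ← map_mul]
    simp
  choose T hT using fun h : inertia σ => mem_inertia_iff.mp h.2
  have hact : ∀ k k' : K, ρ k = ρ k' → σ k = σ k' := by
    intro k k' h
    ext v
    exact LinearMap.congr_fun h v
  let S : inertia σ → V.toSubmodule ≃ₗ[F] V.toSubmodule := fun h => T (rep h) * actEquiv σ (κ h)
  have hS : ∀ h : inertia σ, IsTwist σ (h : G) (S h) := by
    intro h k v
    rw [← conjRep_eq_of_eq V (hκ' h)]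
    exact ((hT (rep h)).mul (IsTwist.actEquiv σ (κ h))) k v
  have hrep_mul : ∀ h : inertia σ, ∀ l ∈ L, rep (h * l) = rep h := by
    intro h l hl
    change Quotient.out _ = Quotient.out _
    congr 1
    exact QuotientGroup.mk_mul_of_mem h hl
  have hSmul : ∀ (h : inertia σ) (k : K) v, S (h * ⟨k, hV.le_inertia k.2⟩) v = S h (σ k v) := by
    intro h k v
    have hr := hrep_mul h ⟨k, hV.le_inertia k.2⟩
      (Subgroup.mem_subgroupOf.mpr (Subgroup.mem_sup_left k.2))
    have e : σ (κ (h * ⟨k, hV.le_inertia k.2⟩)) = σ (κ h * k) := by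
      apply hact
      rw [← hκ, hr, ← mul_assoc, Subgroup.coe_mul, map_mul, hκ, ← map_mul]
      rfl
    change T _ (σ _ v) = T _ (σ _ (σ k v))
    rw [hr, e, map_mul]
    rfl
  have hSloc : ∀ h h' : inertia σ, ρ h' = ρ h → S h' = S h := by
    intro h h' hh
    have hmem : h⁻¹ * h' ∈ L := by
      refine Subgroup.mem_subgroupOf.mpr (Subgroup.mem_sup_right ?_)
      rw [MonoidHom.mem_ker, Subgroup.coe_mul, map_mul, hh, ← map_mul]
      simp
    have hr : rep h' = rep h := by
      have := hrep_mul h _ hmem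
      rwa [mul_inv_cancel_left] at this
    have e : σ (κ h') = σ (κ h) := by
      apply hact
      rw [← hκ, ← hκ, hr, Subgroup.coe_mul, Subgroup.coe_mul, map_mul, map_mul, hh]
    ext1 v
    change T _ (σ _ v) = T _ (σ _ v)
    rw [hr, e]
  -- Left multiplication by the inverse of `S 1` normalises the value at 1; compatibility with `K`
  -- is on the right and is unaffected.
  refine ⟨⟨fun h => (S 1)⁻¹ * S h, fun h => ?_, inv_mul_cancel _, fun h k v => ?_, ?_⟩⟩
  · have := (hS 1).inv.mul (hS h)
    simpa using this
  · exact congrArg (S 1).symm (hSmul h k v)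
  · rw [IsLocallyConstant.iff_exists_open]
    intro h
    refine ⟨{h' | ρ h' = ρ h}, ((isLocallyConstant_of_finite hρ).isOpen_fiber _).preimage
      continuous_subtype_val, rfl, fun h' hh => ?_⟩
    rw [hSloc h h' hh]

end TwistSystem

/-! ### The action γ, the cocycle α and the extension of V -/

section Cocycle

variable {F G V : Type*} [Field F] [Finite F] [Group G] [TopologicalSpace G]
  {K : Subgroup G} [K.Normal] [CompactSpace K]
  [AddCommGroup V] [Module F V] [TopologicalSpace V] [DiscreteTopology V]

omit [Finite F] [CompactSpace ↥K] [DiscreteTopology V] in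
theorem toQuotient_eq_iff {σ : Representation F K V} (hσ : IsIrreducibleModule σ)
    {g h : inertia σ} :
    toQuotient σ g = toQuotient σ h ↔ ∃ k : K, h = g * ⟨k, hσ.le_inertia k.2⟩ := by
  refine QuotientGroup.eq.trans ⟨fun H => ⟨⟨_, Subgroup.mem_subgroupOf.mp H⟩, ?_⟩, ?_⟩
  · ext
    simp
  · rintro ⟨k, rfl⟩
    rw [inv_mul_cancel_left]
    exact Subgroup.mem_subgroupOf.mpr k.2

omit [Finite F] [TopologicalSpace G] [CompactSpace ↥K] [DiscreteTopology V] in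
theorem toQuotient_surjective (σ : Representation F K V) :
    Function.Surjective (toQuotient σ) :=
  QuotientGroup.mk'_surjective _

omit [Finite F] [TopologicalSpace G] [CompactSpace ↥K] [DiscreteTopology V] in
theorem toQuotient_out {σ : Representation F K V} (q : InertiaQuotient σ) :
    toQuotient σ q.out = q :=
  QuotientGroup.out_eq' q

omit [Finite F] [CompactSpace ↥K] [DiscreteTopology V] in
theorem isOpenQuotientMap_toQuotient [IsTopologicalGroup G] (σ : Representation F K V) :
    IsOpenQuotientMap (toQuotient σ) :=
  QuotientGroup.isOpenQuotientMap_mk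

theorem isLocallyConstant_of_comp {X Y Z : Type*} [TopologicalSpace X] [TopologicalSpace Y]
    {p : X → Y} (hp : IsOpenQuotientMap p) {f : Y → Z} (hf : IsLocallyConstant (f ∘ p)) :
    IsLocallyConstant f := fun s => by
  rw [← hp.isQuotientMap.isOpen_preimage]
  exact hf s

namespace TwistSystem

variable {σ : Representation F K V} {hσ : IsIrreducibleModule σ} (t : TwistSystem hσ)

omit [Finite F] [CompactSpace ↥K] [DiscreteTopology V] in
theorem twist_coe (k : K) (v : V) : t.twist ⟨k, hσ.le_inertia k.2⟩ v = σ k v := by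
  have := t.twist_mul 1 k v
  rwa [one_mul, t.twist_one] at this

/-- The cocycle on the inertia group measuring the failure of the twists to be multiplicative. -/
def cocycle (g h : inertia σ) : (EndField hσ)ˣ :=
  ((t.isTwist g).mul (t.isTwist h)).ratio hσ (t.isTwist (g * h))

theorem twist_twist (g h : inertia σ) (v : V) :
    t.twist g (t.twist h v) = (t.cocycle g h : EndField hσ) • t.twist (g * h) v :=
  (((t.isTwist g).mul (t.isTwist h)).ratio_smul hσ (t.isTwist (g * h)) v).symm

/-- Twists are surjective and E acts faithfully on V, so identities between scalars can be checked
on twisted vectors; `conj_unique` plays the same role for γ. -/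
theorem cocycle_unique {g h : inertia σ} {c : EndField hσ}
    (hc : ∀ v, t.twist g (t.twist h v) = c • t.twist (g * h) v) : c = t.cocycle g h := by
  apply EndField.ext_smul
  intro v
  obtain ⟨w, rfl⟩ := (t.twist (g * h)).surjective v
  rw [← hc, twist_twist]

/-- The action on the endomorphism field by conjugation with twists. -/
def conj (h : inertia σ) : EndField hσ ≃ₐ[F] EndField hσ :=
  (t.isTwist h).conjEndEquiv hσ

theorem twist_smul (h : inertia σ) (e : EndField hσ) (v : V) :
    t.twist h (e • v) = t.conj h e • t.twist h v :=
  (t.isTwist h).apply_smul hσ e v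

theorem conj_unique {h : inertia σ} {e e' : EndField hσ}
    (he : ∀ v, t.twist h (e • v) = e' • t.twist h v) : e' = t.conj h e := by
  apply EndField.ext_smul
  intro v
  obtain ⟨w, rfl⟩ := (t.twist h).surjective v
  rw [← he, twist_smul]

/-- Both sides compare T_g T_h T_j with T_{ghj}, under the two bracketings. -/
theorem cocycle_condition (g h j : inertia σ) :
    t.conj g (t.cocycle h j) * (t.cocycle g (h * j) : EndField hσ) =
      (t.cocycle g h : EndField hσ) * (t.cocycle (g * h) j : EndField hσ) := by
  apply EndField.ext_smul
  intro v
  obtain ⟨w, rfl⟩ := (t.twist (g * h * j)).surjective v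
  rw [EndField.mul_smul, EndField.mul_smul, ← twist_twist, ← twist_twist, mul_assoc g h j,
    ← twist_twist, ← twist_smul, ← twist_twist]

theorem cocycle_mul_right (g h : inertia σ) (k k' : K) :
    t.cocycle (g * ⟨k, hσ.le_inertia k.2⟩) (h * ⟨k', hσ.le_inertia k'.2⟩) = t.cocycle g h := by
  symm
  ext1
  apply cocycle_unique
  intro v
  -- Normality moves k past h, as g k h k' = g h (h⁻¹kh) k'; the twist T_h performs the same
  -- conjugation on σ(k).
  have e : g * ⟨k, hσ.le_inertia k.2⟩ * (h * ⟨k', hσ.le_inertia k'.2⟩) =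
      g * h * ⟨(MulAut.conjNormal (h : G)⁻¹ k * k' : K), hσ.le_inertia (Subtype.property _)⟩ := by
    ext
    simp [mul_assoc]
  rw [e, t.twist_mul, t.twist_mul, t.twist_mul, map_mul, Module.End.mul_apply,
    ← t.isTwist h, conjRep_apply, twist_twist]

/-- The action of the inertia group on the endomorphism field. -/
def conjHom : inertia σ →* (EndField hσ ≃ₐ[F] EndField hσ) where
  toFun := t.conj
  map_one' := by
    ext1 e
    symm
    apply t.conj_unique
    intro v
    rw [t.twist_one]
    rfl
  map_mul' g h := by
    ext1 e
    symm
    apply t.conj_unique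
    intro v
    -- The twists are only projectively multiplicative, but the scalar cancels under conjugation
    -- because E is commutative.
    have h1 : ∀ w, t.twist (g * h) w =
        ((t.cocycle g h)⁻¹ : (EndField hσ)ˣ).1 • t.twist g (t.twist h w) := by
      intro w
      rw [twist_twist, ← EndField.mul_smul, Units.inv_mul, one_smul]
    rw [h1, h1, twist_smul, twist_smul, ← EndField.mul_smul, ← EndField.mul_smul, mul_comm]
    rfl

/-- The action of the inertia quotient on the endomorphism field. -/
def quotientAction : InertiaQuotient σ →* (EndField hσ ≃ₐ[F] EndField hσ) :=
  QuotientGroup.lift _ t.conjHom fun h hh => by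
    ext1 e
    symm
    apply t.conj_unique
    intro v
    -- On `K` the twist is σ(k), which commutes with E, so γ is trivial there.
    have := t.twist_coe ⟨h, Subgroup.mem_subgroupOf.mp hh⟩
    rw [this, this]
    exact (EndField.smul_comm_act e _ v).symm

theorem quotientAction_toQuotient (h : inertia σ) :
    t.quotientAction (toQuotient σ h) = t.conj h := rfl

/-- The cocycle on the inertia quotient. -/
def quotientCocycle (p : InertiaQuotient σ × InertiaQuotient σ) : (EndField hσ)ˣ :=
  t.cocycle p.1.out p.2.out

theorem quotientCocycle_toQuotient (g h : inertia σ) :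
    t.quotientCocycle (toQuotient σ g, toQuotient σ h) = t.cocycle g h := by
  obtain ⟨k, hk⟩ := (toQuotient_eq_iff hσ).mp (toQuotient_out (toQuotient σ g)).symm
  obtain ⟨k', hk'⟩ := (toQuotient_eq_iff hσ).mp (toQuotient_out (toQuotient σ h)).symm
  rw [quotientCocycle, hk, hk', cocycle_mul_right]

variable [IsTopologicalGroup G]

theorem isLocallyConstant_quotientAction : IsLocallyConstant t.quotientAction := by
  apply isLocallyConstant_of_comp (isOpenQuotientMap_toQuotient σ)
  rw [IsLocallyConstant.iff_exists_open]
  intro g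
  obtain ⟨U, hU, hg, h⟩ := t.isLocallyConstant.exists_open g
  refine ⟨U, hU, hg, fun g' hg' => ?_⟩
  ext1 e
  apply t.conj_unique
  intro v
  rw [← h g' hg']
  exact t.twist_smul g' e v

theorem isLocallyConstant_quotientCocycle : IsLocallyConstant t.quotientCocycle := by
  -- Openness matters here: a product of open quotient maps is again a quotient map.
  apply isLocallyConstant_of_comp
    ((isOpenQuotientMap_toQuotient σ).prodMap (isOpenQuotientMap_toQuotient σ))
  have hloc : IsLocallyConstant fun p : inertia σ × inertia σ =>
      (t.twist p.1, t.twist p.2, t.twist (p.1 * p.2)) :=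
    (t.isLocallyConstant.comp_continuous continuous_fst).prodMk
      ((t.isLocallyConstant.comp_continuous continuous_snd).prodMk
        (t.isLocallyConstant.comp_continuous continuous_mul))
  rw [IsLocallyConstant.iff_exists_open]
  intro p
  obtain ⟨U, hU, hp, h⟩ := hloc.exists_open p
  refine ⟨U, hU, hp, fun p' hp' => ?_⟩
  change t.quotientCocycle (toQuotient σ p'.1, toQuotient σ p'.2) =
    t.quotientCocycle (toQuotient σ p.1, toQuotient σ p.2)
  rw [quotientCocycle_toQuotient, quotientCocycle_toQuotient]
  ext1
  apply cocycle_unique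
  have := h p' hp'
  simp only [Prod.mk.injEq] at this
  intro v
  rw [← this.1, ← this.2.1, ← this.2.2, twist_twist]

theorem isTwoCocycle : IsTwoCocycle t.quotientAction t.quotientCocycle where
  isLocallyConstant := t.isLocallyConstant_quotientCocycle
  cocycle g h j := by
    obtain ⟨g, rfl⟩ := toQuotient_surjective σ g
    obtain ⟨h, rfl⟩ := toQuotient_surjective σ h
    obtain ⟨j, rfl⟩ := toQuotient_surjective σ j
    rw [← map_mul, ← map_mul, quotientAction_toQuotient]
    simp only [quotientCocycle_toQuotient]
    exact t.cocycle_condition g h j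

/-- The extension of `V` to a crossed projective representation of its inertia group. -/
def extension : CrossedRep (t.quotientAction.comp (toQuotient σ))
    (t.quotientCocycle ∘ Prod.map (toQuotient σ) (toQuotient σ)) V where
  act h :=
    { toFun := t.twist h
      map_add' := map_add _
      map_smul' := t.twist_smul h }
  act_one v := by
    change t.twist 1 v = v
    rw [t.twist_one]
    rfl
  act_act g h v := by
    change t.twist g (t.twist h v) =
      (t.quotientCocycle (toQuotient σ g, toQuotient σ h) : EndField hσ) • t.twist (g * h) v
    rw [quotientCocycle_toQuotient, twist_twist]
  isLocallyConstant_act v := t.isLocallyConstant.comp fun T => T v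

omit [IsTopologicalGroup G] in
theorem extension_act (h : inertia σ) (v : V) : t.extension.act h v = t.twist h v := rfl

end TwistSystem

end Cocycle

/-! ### The multiplicity space Hom_K(V, W) -/

section Hom

variable {F G V W : Type*} [Field F] [Finite F] [Group G] [TopologicalSpace G]
  {K : Subgroup G} [K.Normal] [CompactSpace K]
  [AddCommGroup V] [Module F V] [TopologicalSpace V] [DiscreteTopology V]
  [AddCommGroup W] [Module F W]

/-- The subspace of `K`-linear maps from `V` to `W`. -/
def homSubmodule (σ : Representation F K V) (ρ : Representation F G W) : Submodule F (V →ₗ[F] W) where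
  carrier := {u | ∀ (k : K) v, u (σ k v) = ρ k (u v)}
  add_mem' {u u'} hu hu' k v := by
    rw [LinearMap.add_apply, LinearMap.add_apply, hu, hu', map_add]
  zero_mem' k v := by simp
  smul_mem' c u hu k v := by
    rw [LinearMap.smul_apply, LinearMap.smul_apply, hu, map_smul]

/-- The space of `K`-linear maps from `V` to `W`. -/
def HomSpace (σ : Representation F K V) (ρ : Representation F G W) : Type _ :=
  homSubmodule σ ρ

namespace HomSpace

instance (σ : Representation F K V) (ρ : Representation F G W) : AddCommGroup (HomSpace σ ρ) :=
  inferInstanceAs (AddCommGroup (homSubmodule σ ρ))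

instance (σ : Representation F K V) (ρ : Representation F G W) : Module F (HomSpace σ ρ) :=
  inferInstanceAs (Module F (homSubmodule σ ρ))

instance [Finite V] [Finite W] (σ : Representation F K V) (ρ : Representation F G W) :
    Finite (HomSpace σ ρ) := by
  have : Finite (V →ₗ[F] W) := DFunLike.finite _
  exact inferInstanceAs (Finite (homSubmodule σ ρ))

variable {σ : Representation F K V} (hσ : IsIrreducibleModule σ) {ρ : Representation F G W}

omit [Finite F] [TopologicalSpace G] [K.Normal] [CompactSpace ↥K] [TopologicalSpace V]
  [DiscreteTopology V] in
theorem apply_act (u : HomSpace σ ρ) (k : K) (v : V) : u.1 (σ k v) = ρ k (u.1 v) := u.2 k v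

omit [Finite F] [TopologicalSpace G] [K.Normal] [CompactSpace ↥K] [TopologicalSpace V]
  [DiscreteTopology V] in
theorem ext {u u' : HomSpace σ ρ} (h : ∀ v, u.1 v = u'.1 v) : u = u' :=
  Subtype.ext (LinearMap.ext h)

/-- Evaluation of homomorphisms, as a biadditive map. -/
def eval (σ : Representation F K V) (ρ : Representation F G W) : HomSpace σ ρ →+ V →+ W where
  toFun u := u.1.toAddMonoidHom
  map_zero' := rfl
  map_add' _ _ := rfl

omit [Finite F] [TopologicalSpace G] [K.Normal] [CompactSpace ↥K] [TopologicalSpace V]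
  [DiscreteTopology V] in
theorem sum_apply {J : Type*} (s : Finset J) (u : J → HomSpace σ ρ) (v : V) :
    (∑ j ∈ s, u j).1 v = ∑ j ∈ s, (u j).1 v :=
  (congrArg (· v) (map_sum (eval σ ρ) u s)).trans (AddMonoidHom.finsetSum_apply _ _ _)

/-- The endomorphism field acts on the space of homomorphisms by precomposition. -/
instance instModuleEndField : Module (EndField hσ) (HomSpace σ ρ) where
  smul e u := ⟨u.1 ∘ₗ e.1, fun k v => by
    rw [LinearMap.comp_apply, LinearMap.comp_apply, ← apply_act]
    exact congrArg u.1 (EndField.smul_comm_act e k v)⟩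
  one_smul u := rfl
  mul_smul e e' u := by
    -- Precomposition is a right action; commutativity of E makes it a left one.
    rw [mul_comm]
    rfl
  smul_zero e := rfl
  smul_add e u u' := rfl
  add_smul e e' u := ext fun v => map_add u.1 _ _
  zero_smul u := ext fun v => map_zero u.1

omit [K.Normal] [DiscreteTopology V] in
theorem smul_apply (e : EndField hσ) (u : HomSpace σ ρ) (v : V) : (e • u).1 v = u.1 (e • v) := rfl

omit [Finite F] [TopologicalSpace G] [K.Normal] [CompactSpace ↥K] [TopologicalSpace V]
  [DiscreteTopology V] in
theorem add_apply (u u' : HomSpace σ ρ) (v : V) : (u + u').1 v = u.1 v + u'.1 v := rfl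

instance instIsScalarTower : IsScalarTower F (EndField hσ) (HomSpace σ ρ) where
  smul_assoc c e u := ext fun v => by
    rw [smul_apply, smul_assoc, map_smul]
    rfl

variable {hσ} (t : TwistSystem hσ)

/-- The action of the inertia group on the space of homomorphisms. -/
def act (h : inertia σ) (u : HomSpace σ ρ) : HomSpace σ ρ :=
  ⟨ρ h ∘ₗ u.1 ∘ₗ (t.twist h).symm.toLinearMap, fun k v => by
    have := (t.isTwist h).symm_apply k v
    simp only [LinearMap.comp_apply, LinearEquiv.coe_coe, this]
    rw [conjRep_apply, apply_act, ← Module.End.mul_apply, ← map_mul,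
      ← Module.End.mul_apply (f := ρ k), ← map_mul]
    congr 2
    simp [mul_assoc]⟩

omit [Finite F] [CompactSpace ↥K] [DiscreteTopology V] in
theorem act_apply (h : inertia σ) (u : HomSpace σ ρ) (v : V) :
    (act t h u).1 v = ρ h (u.1 ((t.twist h).symm v)) := rfl

omit [Finite F] [CompactSpace ↥K] [DiscreteTopology V] in
theorem act_apply_twist (h : inertia σ) (u : HomSpace σ ρ) (v : V) :
    (act t h u).1 (t.twist h v) = ρ h (u.1 v) := by
  rw [act_apply, LinearEquiv.symm_apply_apply]

omit [Finite F] [CompactSpace ↥K] [DiscreteTopology V] in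
theorem ext_twist (h : inertia σ) {u u' : HomSpace σ ρ}
    (H : ∀ v, u.1 (t.twist h v) = u'.1 (t.twist h v)) : u = u' := by
  apply ext
  intro v
  obtain ⟨w, rfl⟩ := (t.twist h).surjective v
  exact H w

omit [Finite F] [CompactSpace ↥K] [DiscreteTopology V] in
-- K-linearity of u cancels ρ(k) against σ(k)⁻¹, so the action factors through H/K.
theorem act_mul_right (h : inertia σ) (k : K) (u : HomSpace σ ρ) :
    act t (h * ⟨k, hσ.le_inertia k.2⟩) u = act t h u := by
  apply ext_twist t (h * ⟨k, hσ.le_inertia k.2⟩)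
  intro v
  rw [act_apply_twist, t.twist_mul, act_apply_twist, apply_act, Subgroup.coe_mul, map_mul]
  rfl

omit [Finite F] [CompactSpace ↥K] [DiscreteTopology V] in
theorem act_out (h : inertia σ) (u : HomSpace σ ρ) :
    act t (toQuotient σ h).out u = act t h u := by
  obtain ⟨k, hk⟩ := (toQuotient_eq_iff hσ).mp (toQuotient_out (toQuotient σ h)).symm
  rw [hk, act_mul_right]

theorem act_smul (h : inertia σ) (e : EndField hσ) (u : HomSpace σ ρ) :
    act t h (e • u) = t.conj h e • act t h u := by
  apply ext_twist t h
  intro v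
  rw [act_apply_twist, smul_apply, smul_apply, ← t.twist_smul, act_apply_twist]

/-- The twists enter inverted, as T_h⁻¹ T_g⁻¹ = (α(g,h) T_{gh})⁻¹, which is why the cocycle is
inverted. -/
theorem act_act (g h : inertia σ) (u : HomSpace σ ρ) :
    act t g (act t h u) = ((t.cocycle g h)⁻¹ : (EndField hσ)ˣ).1 • act t (g * h) u := by
  apply ext
  intro v
  obtain ⟨w, rfl⟩ := (t.twist g).surjective v
  obtain ⟨w, rfl⟩ := (t.twist h).surjective w
  rw [act_apply_twist, act_apply_twist, smul_apply, t.twist_twist, ← EndField.mul_smul,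
    Units.inv_mul, one_smul, act_apply_twist, Subgroup.coe_mul, map_mul]
  rfl

variable [IsTopologicalGroup G] [TopologicalSpace W] [DiscreteTopology W] [Finite W]

/-- The space of homomorphisms as a crossed projective representation of the inertia quotient. -/
def crossedRep (hρ : IsProfiniteModule ρ) :
    CrossedRep t.quotientAction t.quotientCocycle⁻¹ (HomSpace σ ρ) where
  act q :=
    { toFun := act t q.out
      map_add' u u' := ext fun v => by
        simp only [act_apply, add_apply, map_add]
      map_smul' e u := by
        rw [act_smul, ← t.quotientAction_toQuotient, toQuotient_out]
        rfl }
  act_one u := by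
    change act t (1 : InertiaQuotient σ).out u = u
    rw [← map_one (toQuotient σ), act_out]
    apply ext_twist t 1
    intro v
    rw [act_apply_twist, t.twist_one, Subgroup.coe_one, map_one]
    rfl
  act_act g h u := by
    obtain ⟨g, rfl⟩ := toQuotient_surjective σ g
    obtain ⟨h, rfl⟩ := toQuotient_surjective σ h
    change act t (toQuotient σ g).out (act t (toQuotient σ h).out u) =
      ((t.quotientCocycle (toQuotient σ g, toQuotient σ h))⁻¹ : (EndField hσ)ˣ).1 •
        act t (toQuotient σ g * toQuotient σ h).out u
    rw [← map_mul, act_out, act_out, act_out, t.quotientCocycle_toQuotient, act_act]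
  isLocallyConstant_act u := by
    apply isLocallyConstant_of_comp (isOpenQuotientMap_toQuotient σ)
    change IsLocallyConstant fun h => act t (toQuotient σ h).out u
    simp only [act_out]
    apply IsLocallyConstant.desc _ Subtype.val _ Subtype.val_injective
    exact ((isLocallyConstant_of_finite hρ).comp_continuous continuous_subtype_val).comp₂
      t.isLocallyConstant fun (a : Module.End F W) (T : V ≃ₗ[F] V) =>
        a ∘ₗ u.1 ∘ₗ T.symm.toLinearMap

theorem crossedRep_act (hρ : IsProfiniteModule ρ) (h : inertia σ) (u : HomSpace σ ρ) :
    (crossedRep t hρ).act (toQuotient σ h) u = act t h u :=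
  act_out t h u

end HomSpace

end Hom

/-! ### Bases of subspaces over E -/

section LinearAlgebra

variable {E M : Type*} [Field E] [AddCommGroup M] [Module E M]

theorem exists_linearIndependent_span_eq [Finite M] (S : Submodule E M) :
    ∃ (n : ℕ) (b : Fin n → M), Submodule.span E (Set.range b) = S ∧ LinearIndependent E b := by
  have : Module.Finite E S := Module.Finite.of_finite
  let b := Module.finBasis E S
  refine ⟨_, S.subtype ∘ b, ?_, b.linearIndependent.map' S.subtype (Submodule.ker_subtype S)⟩
  rw [Set.range_comp, ← Submodule.map_span, b.span_eq, Submodule.map_subtype_top]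

theorem linearIndependent_option_elim {J : Type*} {b : J → M} {u : M}
    (hb : LinearIndependent E b) (hu : u ∉ Submodule.span E (Set.range b)) :
    LinearIndependent E fun o : Option J => o.elim u b :=
  linearIndependent_option.mpr ⟨hb, hu⟩

end LinearAlgebra

/-! ### Independence of translates -/

section Independence

/-- A nontrivial linear relation between homomorphisms from irreducible representations
`τ i` gives rise to a relation with coefficients intertwining these representations. -/
theorem exists_intertwining_relation {F K V W ι : Type*} [Field F] [Monoid K]
    [AddCommGroup V] [Module F V] [AddCommGroup W] [Module F W] [Fintype ι] [DecidableEq ι]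
    (τ : ι → Representation F K V) (ρ : Representation F K W)
    (hτ : ∀ i, ∀ S : Submodule F V, (∀ k, ∀ v ∈ S, τ i k v ∈ S) → S = ⊥ ∨ S = ⊤)
    (f : ι → V →ₗ[F] W) (hf : ∀ i k v, f i (τ i k v) = ρ k (f i v))
    {x : ι → V} (hx : ∑ i, f i (x i) = 0) (hx0 : x ≠ 0) :
    ∃ (i₀ : ι) (p : ι → V →ₗ[F] V), p i₀ = LinearMap.id ∧
      (∀ i k v, p i (τ i₀ k v) = τ i k (p i v)) ∧ ∀ v, ∑ i, f i (p i v) = 0 := by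
  classical
  let supp : (ι → V) → Finset ι := fun y => Finset.univ.filter fun i => y i ≠ 0
  have mem_supp : ∀ y i, i ∈ supp y ↔ y i ≠ 0 := by simp [supp]
  -- Take a relation of minimal support. The relations supported inside its support form a K-stable
  -- space `M`; projection to the coordinate `i₀` identifies `M` with the `i₀`-th representation,
  -- and the other coordinates become intertwiners.
  obtain ⟨x, ⟨hx, hx0⟩, hmin⟩ := (measure fun y => (supp y).card).wf.has_min
    {y : ι → V | ∑ i, f i (y i) = 0 ∧ y ≠ 0} ⟨x, hx, hx0⟩
  obtain ⟨i₀, hi₀⟩ := Function.ne_iff.mp hx0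
  let M : Submodule F (ι → V) :=
    { carrier := {y | ∑ i, f i (y i) = 0 ∧ ∀ i, x i = 0 → y i = 0}
      add_mem' := by
        rintro y z ⟨hy, hy'⟩ ⟨hz, hz'⟩
        refine ⟨?_, fun i hi => ?_⟩
        · simp only [Pi.add_apply, map_add, Finset.sum_add_distrib, hy, hz, add_zero]
        · rw [Pi.add_apply, hy' i hi, hz' i hi, add_zero]
      zero_mem' := by simp
      smul_mem' := by
        rintro c y ⟨hy, hy'⟩
        refine ⟨?_, fun i hi => ?_⟩
        · simp only [Pi.smul_apply, map_smul, ← Finset.smul_sum, hy, smul_zero]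
        · rw [Pi.smul_apply, hy' i hi, smul_zero] }
  have hM : ∀ y ∈ M, ∀ k, (fun i => τ i k (y i)) ∈ M := by
    rintro y ⟨hy, hy'⟩ k
    refine ⟨?_, fun i hi => ?_⟩
    · simp only [hf, ← map_sum, hy, map_zero]
    · simp only [hy' i hi, map_zero]
  let π : M →ₗ[F] V := LinearMap.proj i₀ ∘ₗ M.subtype
  have hπ : ∀ y : M, π y = y.1 i₀ := fun _ => rfl
  -- A nonzero relation in the kernel would lose `i₀` from its support, against minimality.
  have hinj : Function.Injective π := by
    rw [← LinearMap.ker_eq_bot, LinearMap.ker_eq_bot']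
    rintro ⟨y, hy, hy'⟩ h0
    by_contra hne
    refine hmin y ⟨hy, fun h => hne (Subtype.ext h)⟩ (Finset.card_lt_card ?_)
    refine (Finset.ssubset_iff_of_subset fun i hi => ?_).mpr
      ⟨i₀, (mem_supp _ _).mpr hi₀, fun h => (mem_supp _ _).mp h h0⟩
    rw [mem_supp] at hi ⊢
    exact fun h => hi (hy' i h)
  have hsurj : Function.Surjective π := by
    rw [← LinearMap.range_eq_top]
    refine (hτ i₀ _ ?_).resolve_left fun h => hi₀ ?_
    · rintro k _ ⟨y, rfl⟩
      exact ⟨⟨_, hM y y.2 k⟩, rfl⟩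
    · have : π ⟨x, hx, fun _ h => h⟩ ∈ LinearMap.range π := LinearMap.mem_range_self _ _
      rwa [h, Submodule.mem_bot] at this
  let e : M ≃ₗ[F] V := LinearEquiv.ofBijective π ⟨hinj, hsurj⟩
  have he : ∀ v, (e.symm v).1 i₀ = v := e.apply_symm_apply
  have he_act : ∀ k v, (e.symm (τ i₀ k v)).1 = fun i => τ i k ((e.symm v).1 i) := by
    intro k v
    have : e.symm (τ i₀ k v) = ⟨_, hM _ (e.symm v).2 k⟩ := by
      apply e.injective
      rw [e.apply_symm_apply]
      exact (congrArg (τ i₀ k) (he v)).symm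
    rw [this]
  refine ⟨i₀, fun i => LinearMap.proj i ∘ₗ M.subtype ∘ₗ e.symm.toLinearMap, LinearMap.ext he,
    fun i k v => congrFun (he_act k v) i, fun v => (e.symm v).2.1⟩

variable {F G V W : Type*} [Field F] [Finite F] [Group G] [TopologicalSpace G]
  {K : Subgroup G} [K.Normal] [CompactSpace K]
  [AddCommGroup V] [Module F V] [TopologicalSpace V] [DiscreteTopology V]
  [AddCommGroup W] [Module F W]

omit [Finite F] [CompactSpace ↥K] in
theorem IsIrreducibleModule.eq_bot_or_eq_top_of_conjRep {σ : Representation F K V}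
    (hσ : IsIrreducibleModule σ) (g : G) (S : Submodule F V)
    (hS : ∀ k, ∀ v ∈ S, conjRep σ g k v ∈ S) : S = ⊥ ∨ S = ⊤ := by
  let S' : Subrepresentation σ := ⟨S, fun k v hv => by
    rw [← conjRep_conjNormal σ g k]
    exact hS _ v hv⟩
  exact (hσ.eq_bot_or_eq_top S' (isClosed_discrete _)).imp
    (congrArg Subrepresentation.toSubmodule) (congrArg Subrepresentation.toSubmodule)

omit [Finite F] [CompactSpace ↥K] in
-- Schur's lemma: a nonzero p is injective, hence bijective as V is finite, and is then a twist for
-- h⁻¹g.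
theorem eq_zero_of_intertwining [Finite V] {σ : Representation F K V}
    (hσ : IsIrreducibleModule σ) {g h : G} (p : V →ₗ[F] V)
    (hp : ∀ k v, p (conjRep σ g k v) = conjRep σ h k (p v)) (hgh : h⁻¹ * g ∉ inertia σ) :
    p = 0 := by
  rcases hσ.eq_bot_or_eq_top_of_conjRep g (LinearMap.ker p) (fun k v hv => by
    rw [LinearMap.mem_ker] at hv ⊢
    rw [hp, hv, map_zero]) with hker | hker
  · exfalso
    have hinj : Function.Injective p := LinearMap.ker_eq_bot.mp hker
    let T : V ≃ₗ[F] V := LinearEquiv.ofBijective p ⟨hinj, Finite.surjective_of_injective hinj⟩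
    refine hgh (mem_inertia_iff.mpr ⟨T, fun k v => ?_⟩)
    have := hp (MulAut.conjNormal h k) v
    rw [conjRep_conjNormal] at this
    rw [conjRep_mul, conjRep_apply, inv_inv]
    exact this
  · exact LinearMap.ker_eq_top.mp hker

/-- The translates of linearly independent homomorphisms to the cosets of the inertia group are
jointly injective. -/
theorem eq_zero_of_sum_translates_eq_zero [Finite V] {σ : Representation F K V}
    (hσ : IsIrreducibleModule σ) (ρ : Representation F G W) {J : Type*} [Fintype J]
    [Fintype (G ⧸ inertia σ)] {b : J → HomSpace σ ρ} (hb : LinearIndependent (EndField hσ) b)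
    {x : (G ⧸ inertia σ) × J → V} (hx : ∑ i, ρ i.1.out ((b i.2).1 (x i)) = 0) : x = 0 := by
  classical
  by_contra hx0
  obtain ⟨⟨q, j₀⟩, p, hp₀, hp, hsum⟩ := exists_intertwining_relation
    (fun i : (G ⧸ inertia σ) × J => conjRep σ i.1.out) (res K ρ)
    (fun i => hσ.eq_bot_or_eq_top_of_conjRep i.1.out) (fun i => ρ i.1.out ∘ₗ (b i.2).1)
    (fun i k v => by
      rw [LinearMap.comp_apply, LinearMap.comp_apply, conjRep_apply, HomSpace.apply_act]
      change _ = ρ k _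
      rw [← Module.End.mul_apply, ← map_mul, ← Module.End.mul_apply (f := ρ k), ← map_mul]
      congr 2
      simp [mul_assoc]) hx hx0
  have hpq : ∀ q' j, q' ≠ q → p (q', j) = 0 := by
    intro q' j hq
    refine eq_zero_of_intertwining hσ _ (hp (q', j)) fun hmem => hq ?_
    rw [← QuotientGroup.out_eq' q', ← QuotientGroup.out_eq' q]
    exact QuotientGroup.eq.mpr hmem
  -- Within the coset q, the intertwiners are endomorphisms of one conjugate of V, hence scalars in
  -- E. Independence of `b` kills them, although the one at `j₀` is the identity.
  let e : J → EndField hσ := fun j => EndField.ofEnd hσ (p (q, j)) fun k v => by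
    have := hp (q, j) (MulAut.conjNormal q.out k) v
    simpa only [conjRep_conjNormal] using this
  have he : ∑ j, e j • b j = 0 := by
    apply HomSpace.ext
    intro v
    have h1 : ρ q.out ((∑ j, e j • b j : HomSpace σ ρ).1 v) = 0 := by
      rw [← hsum v, Fintype.sum_prod_type, Finset.sum_eq_single q, HomSpace.sum_apply, map_sum]
      · rfl
      · intro q' _ hq'
        refine Finset.sum_eq_zero fun j _ => ?_
        rw [hpq q' j hq', LinearMap.zero_apply, map_zero]
      · simp
    have h2 := congrArg (ρ q.out⁻¹) h1
    rwa [map_zero, ← Module.End.mul_apply, ← map_mul, inv_mul_cancel, map_one] at h2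
  have he₀ : e j₀ = 0 := Fintype.linearIndependent_iff.mp hb e he j₀
  obtain ⟨v, hv⟩ := @exists_ne V hσ.nontrivial 0
  apply hv
  have : e j₀ • v = v := LinearMap.congr_fun hp₀ v
  rw [← this, he₀, zero_smul]

end Independence

/-! ### Generation of W and irreducibility of the multiplicity space -/

section Generation

variable {F G V W : Type*} [Field F] [Finite F] [Group G] [TopologicalSpace G]
  {K : Subgroup G} [K.Normal] [CompactSpace K]
  [AddCommGroup V] [Module F V] [TopologicalSpace V] [DiscreteTopology V]
  [AddCommGroup W] [Module F W] [TopologicalSpace W] [DiscreteTopology W]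

omit [DiscreteTopology V] in
/-- An irreducible module is generated by the translates of any nonzero stable space of
homomorphisms. -/
theorem exists_sum_translates_eq {σ : Representation F K V}
    {hσ : IsIrreducibleModule σ} (t : TwistSystem hσ) {ρ : Representation F G W}
    (hρ : IsIrreducibleModule ρ) {J : Type*} [Fintype J]
    [Fintype (G ⧸ inertia σ)] (b : J → HomSpace σ ρ)
    {S : Submodule (EndField hσ) (HomSpace σ ρ)} (hSb : S ≤ Submodule.span (EndField hσ) (Set.range b))
    (hS : ∀ h, ∀ u ∈ S, HomSpace.act t h u ∈ S) (hS0 : S ≠ ⊥) (w : W) :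
    ∃ x : (G ⧸ inertia σ) × J → V, ∑ i, ρ i.1.out ((b i.2).1 (x i)) = w := by
  classical
  let R : Subrepresentation ρ :=
    { toSubmodule := Submodule.span F {w | ∃ g, ∃ u ∈ S, ∃ v, w = ρ g (u.1 v)}
      apply_mem_toSubmodule := by
        intro g w hw
        induction hw using Submodule.span_induction with
        | mem w hw =>
          obtain ⟨g', u, hu, v, rfl⟩ := hw
          refine Submodule.subset_span ⟨g * g', u, hu, v, ?_⟩
          rw [map_mul]
          rfl
        | zero => rw [map_zero]; exact zero_mem _
        | add _ _ _ _ h₁ h₂ => rw [map_add]; exact add_mem h₁ h₂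
        | smul c _ _ h => rw [map_smul]; exact Submodule.smul_mem _ c h }
  have hR : R = ⊤ := by
    refine (hρ.eq_bot_or_eq_top R (isClosed_discrete _)).resolve_left fun hbot => hS0 ?_
    rw [Submodule.eq_bot_iff]
    intro u hu
    apply HomSpace.ext
    intro v
    have : u.1 v ∈ R.toSubmodule := Submodule.subset_span ⟨1, u, hu, v, by rw [map_one]; rfl⟩
    rw [hbot] at this
    exact this
  let Φ : ((G ⧸ inertia σ) × J → V) →ₗ[F] W :=
    ∑ i : (G ⧸ inertia σ) × J, ρ i.1.out ∘ₗ (b i.2).1 ∘ₗ LinearMap.proj i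
  have hΦ : ∀ x, Φ x = ∑ i, ρ i.1.out ((b i.2).1 (x i)) := fun x => by
    simp [Φ, LinearMap.sum_apply]
  suffices R.toSubmodule ≤ LinearMap.range Φ by
    obtain ⟨x, hx⟩ := this (x := w) (by rw [hR]; exact Submodule.mem_top (R := F))
    exact ⟨x, (hΦ x).symm.trans hx⟩
  refine Submodule.span_le.mpr ?_
  rintro _ ⟨g, u, hu, v, rfl⟩
  have hmem : (g : G ⧸ inertia σ).out⁻¹ * g ∈ inertia σ :=
    QuotientGroup.eq.mp (QuotientGroup.out_eq' _)
  set q : G ⧸ inertia σ := (g : G ⧸ inertia σ)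
  let h : inertia σ := ⟨_, hmem⟩
  obtain ⟨c, hc⟩ := (Submodule.mem_span_range_iff_exists_fun _).mp (hSb (hS h u hu))
  -- Write g as its coset representative times h in H; h moves u inside S, which is spanned by `b`,
  -- at the cost of twisting v.
  have key : ρ g (u.1 v) = ∑ j, ρ q.out ((b j).1 (c j • t.twist h v)) := by
    have h1 : ρ g (u.1 v) = ρ q.out ((HomSpace.act t h u).1 (t.twist h v)) := by
      rw [HomSpace.act_apply_twist, ← Module.End.mul_apply, ← map_mul]
      congr 2
      simp [h]
    rw [h1, ← hc, HomSpace.sum_apply, map_sum]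
    rfl
  rw [key]
  refine Submodule.sum_mem _ fun j _ => ⟨Pi.single (q, j) (c j • t.twist h v), ?_⟩
  rw [hΦ, Finset.sum_eq_single (q, j), Pi.single_eq_same]
  · intro i _ hi
    rw [Pi.single_eq_of_ne hi, map_zero, map_zero]
  · simp

/-- A nonzero stable proper S would generate W by translates of its basis. For u outside S and v ≠
0, a translate of u(v) is then a combination of them, although the basis together with u is
independent. -/
theorem isIrreducible_crossedRep [Finite V] [Finite W] [IsTopologicalGroup G]
    {σ : Representation F K V}
    {hσ : IsIrreducibleModule σ} (t : TwistSystem hσ) {ρ : Representation F G W}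
    (hρ : IsIrreducibleModule ρ) [Finite (G ⧸ inertia σ)] (hne : Nontrivial (HomSpace σ ρ)) :
    (HomSpace.crossedRep t hρ.toIsProfiniteModule).IsIrreducible := by
  classical
  refine ⟨hne, fun S hS => ?_⟩
  by_contra! hcon
  obtain ⟨hbot, htop⟩ := hcon
  obtain ⟨u, hu⟩ : ∃ u, u ∉ S := by
    by_contra! h
    exact htop (Submodule.eq_top_iff'.mpr h)
  have : Fintype (G ⧸ inertia σ) := Fintype.ofFinite _
  obtain ⟨n, b, hspan, hb⟩ := exists_linearIndependent_span_eq S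
  have hb' := linearIndependent_option_elim hb (hspan ▸ hu)
  have hact : ∀ h, ∀ u ∈ S, HomSpace.act t h u ∈ S := fun h u hu => by
    rw [← HomSpace.crossedRep_act t hρ.toIsProfiniteModule]
    exact hS _ u hu
  obtain ⟨v, hv⟩ := @exists_ne V hσ.nontrivial 0
  let q : G ⧸ inertia σ := (1 : G)
  obtain ⟨x, hx⟩ := exists_sum_translates_eq t hρ b hspan.ge hact
    hbot (ρ q.out (u.1 v))
  have := eq_zero_of_sum_translates_eq_zero hσ ρ hb'
    -- The entry -v sits at u in the trivial coset; the others express the translate of u(v) through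
    -- the basis of S.
    (x := fun i => i.2.elim (if i.1 = q then -v else 0) fun j => x (i.1, j)) (by
      rw [Fintype.sum_prod_type]
      simp only [Fintype.sum_option, Finset.sum_add_distrib, Option.elim]
      rw [Fintype.sum_prod_type] at hx
      rw [hx, Finset.sum_eq_single q]
      · simp
      · intro q' _ hq'
        simp [hq']
      · simp)
  have := congrFun this (q, none)
  simp [hv] at this

end Generation

/-! ### Maps out of an induced representation -/

section Induction

variable {k G H A B : Type*} [CommRing k] [Group G] [Group H] (f : H →* G)
  [AddCommGroup A] [Module k A] (τ : Representation k H A)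
  [AddCommGroup B] [Module k B] (ρ : Representation k G B)

/-- The linear map from an induced representation determined by an equivariant map. -/
def indLift (p : A →ₗ[k] B) (hp : ∀ h a, p (τ h a) = ρ (f h) (p a)) :
    Representation.IndV f τ →ₗ[k] B :=
  Representation.Coinvariants.lift _
    (TensorProduct.lift <| (Finsupp.lift _ _ _ fun g => ρ g⁻¹ ∘ₗ p) ∘ₗ
      (MonoidAlgebra.coeffLinearEquiv k).toLinearMap)
    fun h => by
      ext g a
      simp only [LinearMap.coe_comp, Function.comp_apply, MonoidAlgebra.lsingle_apply]
      simp [mul_inv_rev, hp]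

/-- The inverse reflects the coinvariants model of induction: the class of g ⊗ a plays the role of
g⁻¹ ⊗ a in k[G] ⊗_{k[H]} A. -/
theorem indLift_mk (p : A →ₗ[k] B) (hp : ∀ h a, p (τ h a) = ρ (f h) (p a)) (g : G) (a : A) :
    indLift f τ ρ p hp (Representation.IndV.mk f τ g a) = ρ g⁻¹ (p a) := by
  simp [indLift]

theorem indLift_ind (p : A →ₗ[k] B) (hp : ∀ h a, p (τ h a) = ρ (f h) (p a)) (g : G) :
    indLift f τ ρ p hp ∘ₗ Representation.ind f τ g = ρ g ∘ₗ indLift f τ ρ p hp := by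
  refine Representation.IndV.hom_ext _ _ fun x => LinearMap.ext fun a => ?_
  rw [LinearMap.comp_apply, LinearMap.comp_apply, Representation.ind_mk, indLift_mk,
    LinearMap.comp_apply, LinearMap.comp_apply, indLift_mk]
  rw [mul_inv_rev, inv_inv, map_mul]
  rfl

theorem indV_mk_mul (g : G) (h : H) (a : A) :
    Representation.IndV.mk f τ (f h * g) (τ h a) = Representation.IndV.mk f τ g a := by
  have := Representation.Coinvariants.mk_self_apply
    (Representation.tprod ((Representation.leftRegular k G).comp f) τ) h
    (MonoidAlgebra.single g 1 ⊗ₜ[k] a)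
  simpa using this

end Induction

/-! ### The evaluation isomorphism -/

section Evaluation

variable {F G V : Type*} {W : Type*} [Field F] [Finite F] [Group G] [TopologicalSpace G]
  [IsTopologicalGroup G]
  {K : Subgroup G} [K.Normal] [CompactSpace K]
  [AddCommGroup V] [Module F V] [TopologicalSpace V] [DiscreteTopology V]
  [AddCommGroup W] [Module F W] [TopologicalSpace W] [DiscreteTopology W] [Finite W]
  {σ : Representation F K V} (hσ : IsIrreducibleModule σ) (t : TwistSystem hσ)
  {ρ : Representation F G W}

/-- The evaluation map `u ⊗ v ↦ u v`. -/
def evaluation (ρ : Representation F G W) : HomSpace σ ρ ⊗[EndField hσ] V →ₗ[F] W where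
  toFun := TensorProduct.liftAddHom (HomSpace.eval σ ρ) fun _ _ _ => rfl
  map_add' := map_add _
  map_smul' c x := by
    induction x using TensorProduct.induction_on with
    | zero => simp
    | tmul u v => rfl
    | add x y hx hy =>
      rw [smul_add, map_add, hx, hy, map_add, smul_add]

omit [IsTopologicalGroup G] [TopologicalSpace W] [DiscreteTopology W] [Finite W] in
omit [K.Normal] [DiscreteTopology V] in
theorem evaluation_tmul (u : HomSpace σ ρ) (v : V) :
    evaluation hσ ρ (u ⊗ₜ[EndField hσ] v) = u.1 v := rfl

variable {hσ}

/-- The tensor product of the space of homomorphisms and the extension of `V`. -/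
abbrev tensorRep (hρ : IsProfiniteModule ρ) :
    Representation F (inertia σ) (HomSpace σ ρ ⊗[EndField hσ] V) :=
  tensorInflate (HomSpace.crossedRep t hρ) (toQuotient σ) (continuous_toQuotient σ) t.extension

theorem tensorRep_tmul (hρ : IsProfiniteModule ρ) (h : inertia σ) (u : HomSpace σ ρ) (v : V) :
    tensorRep t hρ h (u ⊗ₜ[EndField hσ] v) =
      HomSpace.act t h u ⊗ₜ[EndField hσ] t.twist h v := by
  rw [tensorRep, tensorInflate_tmul, HomSpace.crossedRep_act, t.extension_act]

theorem evaluation_tensorRep (hρ : IsProfiniteModule ρ) (h : inertia σ)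
    (x : HomSpace σ ρ ⊗[EndField hσ] V) :
    evaluation hσ ρ (tensorRep t hρ h x) = ρ h (evaluation hσ ρ x) := by
  induction x using TensorProduct.induction_on with
  | zero => simp only [map_zero]
  | tmul u v =>
    rw [tensorRep_tmul, evaluation_tmul, evaluation_tmul, HomSpace.act_apply_twist]
  | add x y hx hy => simp only [map_add, hx, hy]

/-- The canonical map from the induced module to `W`. -/
def indEvaluation (hρ : IsProfiniteModule ρ) :
    Representation.IndV (inertia σ).subtype (tensorRep t hρ) →ₗ[F] W :=
  indLift _ _ ρ (evaluation hσ ρ) (evaluation_tensorRep t hρ)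

theorem indEvaluation_mk_tmul (hρ : IsProfiniteModule ρ) (g : G) (u : HomSpace σ ρ) (v : V) :
    indEvaluation t hρ (Representation.IndV.mk _ _ g (u ⊗ₜ[EndField hσ] v)) = ρ g⁻¹ (u.1 v) :=
  indLift_mk _ _ _ _ _ _ _

/-- This normal form over coset representatives and a spanning family reduces injectivity to the
independence of translates, with no dimension count for the induced module. -/
theorem exists_sum_mk_eq (hρ : IsProfiniteModule ρ) {J : Type*} [Fintype J]
    [Fintype (G ⧸ inertia σ)] {b : J → HomSpace σ ρ}
    (hb : Submodule.span (EndField hσ) (Set.range b) = ⊤)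
    (z : Representation.IndV (inertia σ).subtype (tensorRep t hρ)) :
    ∃ x : (G ⧸ inertia σ) × J → V, ∑ i, Representation.IndV.mk (inertia σ).subtype
      (tensorRep t hρ) i.1.out⁻¹ (b i.2 ⊗ₜ[EndField hσ] x i) = z := by
  classical
  let S : AddSubgroup (Representation.IndV (inertia σ).subtype (tensorRep t hρ)) :=
    { carrier := {z | ∃ x : (G ⧸ inertia σ) × J → V, ∑ i, Representation.IndV.mk
        (inertia σ).subtype (tensorRep t hρ) i.1.out⁻¹ (b i.2 ⊗ₜ[EndField hσ] x i) = z}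
      add_mem' := by
        rintro _ _ ⟨x, rfl⟩ ⟨y, rfl⟩
        refine ⟨x + y, ?_⟩
        simp only [Pi.add_apply, TensorProduct.tmul_add, map_add, Finset.sum_add_distrib]
      zero_mem' := ⟨0, by simp only [Pi.zero_apply, TensorProduct.tmul_zero, map_zero,
        Finset.sum_const_zero]⟩
      neg_mem' := by
        rintro _ ⟨x, rfl⟩
        refine ⟨-x, ?_⟩
        simp only [Pi.neg_apply, TensorProduct.tmul_neg, map_neg, Finset.sum_neg_distrib] }
  have single_mem : ∀ (q : G ⧸ inertia σ) j v, Representation.IndV.mk (inertia σ).subtype (tensorRep t hρ)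
      q.out⁻¹ (b j ⊗ₜ[EndField hσ] v) ∈ S := by
    intro q j v
    refine ⟨Pi.single (q, j) v, ?_⟩
    rw [Finset.sum_eq_single (q, j), Pi.single_eq_same]
    · intro i _ hi
      rw [Pi.single_eq_of_ne hi, TensorProduct.tmul_zero, map_zero]
    · simp
  have mk_out_mem : ∀ (q : G ⧸ inertia σ) u v, Representation.IndV.mk (inertia σ).subtype (tensorRep t hρ)
      q.out⁻¹ (u ⊗ₜ[EndField hσ] v) ∈ S := by
    intro q u v
    obtain ⟨c, rfl⟩ := (Submodule.mem_span_range_iff_exists_fun (EndField hσ)).mp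
      (show u ∈ Submodule.span (EndField hσ) (Set.range b) by rw [hb]; trivial)
    rw [TensorProduct.sum_tmul, map_sum]
    refine sum_mem fun j _ => ?_
    rw [TensorProduct.smul_tmul]
    exact single_mem q j _
  have mk_mem : ∀ g a, Representation.IndV.mk (inertia σ).subtype (tensorRep t hρ) g a ∈ S := by
    intro g a
    induction a using TensorProduct.induction_on with
    | zero => rw [map_zero]; exact zero_mem S
    | add x y hx hy => rw [map_add]; exact add_mem hx hy
    | tmul u v =>
      let q : G ⧸ inertia σ := (g⁻¹ : G)
      have hmem : q.out⁻¹ * g⁻¹ ∈ inertia σ := QuotientGroup.eq.mp (QuotientGroup.out_eq' _)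
      let h : inertia σ := ⟨_, hmem⟩
      rw [← indV_mk_mul _ _ g h, tensorRep_tmul]
      have : (inertia σ).subtype h * g = q.out⁻¹ := by simp [h]
      rw [this]
      exact mk_out_mem _ _ _
  change z ∈ S
  induction z using Representation.Coinvariants.induction_on with
  | h z =>
    induction z using TensorProduct.induction_on with
    | zero => rw [map_zero]; exact zero_mem S
    | add x y hx hy => rw [map_add]; exact add_mem hx hy
    | tmul r a =>
      induction r using MonoidAlgebra.induction_linear with
      | zero => rw [TensorProduct.zero_tmul, map_zero]; exact zero_mem S
      | add x y hx hy => rw [TensorProduct.add_tmul, map_add]; exact add_mem hx hy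
      | single g c =>
        have : MonoidAlgebra.single g c ⊗ₜ[F] a = MonoidAlgebra.single g 1 ⊗ₜ[F] (c • a) := by
          rw [← TensorProduct.smul_tmul, MonoidAlgebra.smul_single, smul_eq_mul, mul_one]
        rw [this]
        exact mk_mem g (c • a)

theorem bijective_indEvaluation [Finite V] [Finite (G ⧸ inertia σ)]
    (hρ : IsIrreducibleModule ρ) (hne : Nontrivial (HomSpace σ ρ)) :
    Function.Bijective (indEvaluation t hρ.toIsProfiniteModule) := by
  have : Fintype (G ⧸ inertia σ) := Fintype.ofFinite _
  obtain ⟨n, b, hspan, hb⟩ :=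
    exists_linearIndependent_span_eq (⊤ : Submodule (EndField hσ) (HomSpace σ ρ))
  have hsum : ∀ x : (G ⧸ inertia σ) × Fin n → V,
      indEvaluation t hρ.toIsProfiniteModule (∑ i, Representation.IndV.mk (inertia σ).subtype
        (tensorRep t hρ.toIsProfiniteModule) i.1.out⁻¹ (b i.2 ⊗ₜ[EndField hσ] x i)) =
      ∑ i, ρ i.1.out ((b i.2).1 (x i)) := by
    intro x
    rw [map_sum]
    refine Finset.sum_congr rfl fun i _ => ?_
    rw [indEvaluation_mk_tmul, inv_inv]
  constructor
  · rw [injective_iff_map_eq_zero]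
    intro z hz
    obtain ⟨x, rfl⟩ := exists_sum_mk_eq t hρ.toIsProfiniteModule hspan z
    rw [hsum] at hz
    have hx := eq_zero_of_sum_translates_eq_zero hσ ρ hb hz
    rw [hx]
    simp only [Pi.zero_apply, TensorProduct.tmul_zero, map_zero, Finset.sum_const_zero]
  · intro w
    obtain ⟨x, hx⟩ := exists_sum_translates_eq t hρ b hspan.ge (fun _ _ _ => trivial)
      (by
        obtain ⟨u, hu⟩ := exists_ne (0 : HomSpace σ ρ)
        exact fun h => hu ((Submodule.eq_bot_iff _).mp h u trivial)) w
    exact ⟨_, (hsum x).trans hx⟩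

/-- An irreducible module is induced from the tensor product of a space of homomorphisms with the
extension of an irreducible constituent `V`. -/
def equivInd [Finite V] [Finite (G ⧸ inertia σ)]
    (hρ : IsIrreducibleModule ρ) (hne : Nontrivial (HomSpace σ ρ)) :
    ρ.Equiv (Representation.ind (inertia σ).subtype (tensorRep t hρ.toIsProfiniteModule)) :=
  (Representation.Equiv.mk (LinearEquiv.ofBijective _ (bijective_indEvaluation t hρ hne))
    (indLift_ind _ _ ρ (evaluation hσ ρ) (evaluation_tensorRep t hρ.toIsProfiniteModule))).symm

end Evaluation

/-- The inclusion of V into W is a nonzero K-linear map. -/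
theorem nontrivial_homSpace {F G W : Type*} [Field F] [Group G] [TopologicalSpace G]
    {K : Subgroup G} [AddCommGroup W] [Module F W] [TopologicalSpace W]
    (ρ : Representation F G W) (V : Subrepresentation (res K ρ))
    (hV : IsIrreducibleModule V.toRepresentation) :
    Nontrivial (HomSpace V.toRepresentation ρ) := by
  obtain ⟨v, hv⟩ := @exists_ne _ hV.nontrivial (0 : V.toSubmodule)
  refine ⟨⟨V.toSubmodule.subtype, fun _ _ => rfl⟩, 0, fun h => hv ?_⟩
  exact Subtype.ext (LinearMap.congr_fun (congrArg Subtype.val h) v)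

end TwistedClifford

end

theorem mainTheorem4
    {F : Type*} [Field F] [Finite F]
    {G : Type*} [Group G] [TopologicalSpace G] [IsTopologicalGroup G] [CompactSpace G]
    [T2Space G] [TotallyDisconnectedSpace G]
    (K : Subgroup G) [K.Normal] [IsClosed (K : Set G)]
    {W : Type w} [AddCommGroup W] [Module F W] [TopologicalSpace W]
    (ρ : Representation F G W) (hρ : IsIrreducibleModule ρ)
    (V : Subrepresentation (res K ρ)) (hVs : IsSummand V)
    (hV : IsIrreducibleModule V.toRepresentation) :
    IsOpen (inertia V.toRepresentation : Set G) ∧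
    ∃ (γ : InertiaQuotient V.toRepresentation →* (EndField hV ≃ₐ[F] EndField hV))
      (α : InertiaQuotient V.toRepresentation × InertiaQuotient V.toRepresentation →
        (EndField hV)ˣ),
      IsLocallyConstant γ ∧ IsTwoCocycle γ α ∧
      ∃ extV : CrossedRep (γ.comp (toQuotient V.toRepresentation))
          (α ∘ Prod.map (toQuotient V.toRepresentation) (toQuotient V.toRepresentation))
          V.toSubmodule,
        (∀ (k : K) (v : V.toSubmodule),
          extV.act ⟨k, hV.le_inertia k.2⟩ v = V.toRepresentation k v) ∧
        ∃ (U : Type w) (_ : AddCommGroup U) (_ : Module (EndField hV) U) (_ : Module F U)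
          (_ : IsScalarTower F (EndField hV) U) (_ : Module.Finite (EndField hV) U)
          (ρU : CrossedRep γ α⁻¹ U),
          ρU.IsIrreducible ∧
          ∃ φ : ρ.Equiv (Representation.ind (inertia V.toRepresentation).subtype
              (tensorInflate ρU (toQuotient V.toRepresentation)
                (continuous_toQuotient V.toRepresentation) extV)),
            IsLocallyConstant φ := by
  have : Finite W := hρ.finite
  have : T2Space W := hρ.t2Space
  -- A finite Hausdorff space is discrete, so all continuity conditions on V and W, including that
  -- on φ, become automatic.
  have : DiscreteTopology W := Finite.instDiscreteTopology
  have hopen := isOpen_inertia hρ.toIsProfiniteModule V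
  have : Finite (G ⧸ inertia V.toRepresentation) := Subgroup.quotient_finite_of_isOpen _ hopen
  obtain ⟨t⟩ := exists_twistSystem hρ.toIsProfiniteModule V hV
  have hne := nontrivial_homSpace ρ V hV
  exact ⟨hopen, t.quotientAction, t.quotientCocycle, t.isLocallyConstant_quotientAction,
    t.isTwoCocycle, t.extension, t.twist_coe, HomSpace V.toRepresentation ρ, inferInstance,
    inferInstance, inferInstance, inferInstance, Module.Finite.of_finite,
    HomSpace.crossedRep t hρ.toIsProfiniteModule, isIrreducible_crossedRep t hρ hne,
    equivInd t hρ hne, IsLocallyConstant.of_discrete _⟩
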